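/- Let $n\ge 0$, let $M$ be a smooth manifold of dimension $n+2$ with a smooth pseudo-Riemannian metric $g$, a smooth $1$-form $\eta$ and a smooth affine connection $\nabla$ with torsion $T^\nabla$, such that $(M,g,\eta,\nabla)$ is a semi-Weyl manifold admitting torsion (SWMT), i.e. for all vector fields $X,Y,Z$ $$(\nabla_Xg)(Y,Z)+\eta(X)g(Y,Z)=(\nabla_Yg)(X,Z)+\eta(Y)g(X,Z)-g(T^\nabla(X,Y),Z).$$ For smooth functions $\phi,\psi$ on $M$ let the conformal-projective change be $$\widetilde g=e^{\phi+\psi}g,\qquad \widetilde\nabla_XY=\nabla_XY+d\phi(X)Y+d\phi(Y)X-g(X,Y)\,\mathrm{grad}_g\psi .$$ Let $M'$ be an $(n+1)$-dimensional immersed hypersurface of $M$ which is lightlike, i.e. the induced form $g'=g|_{TM'\times TM'}$ is degenerate at every point, and let $S(TM')$ be an integrable screen distribution, i.e. an integrable smooth distribution on $M'$ complementary in $TM'$ to the radical $\mathrm{Rad}(TM')$ of $g'$. On an open set $U\subset M'$, a null frame is a pair $(\xi,N)$ of a smooth section $\xi$ of $\mathrm{Rad}(TM')$ and a smooth section $N$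 of $TM|_{M'}$ with $g(N,\xi)=1$, $g(N,N)=0$ and $g(N,W)=0$ for all $W\in S(TM')$; for it put $$\beta(X,Y)=-g(\nabla_XN,Y),\qquad X,Y\in S(TM').$$ A point $x\in M'$ is umbilical if, for a null frame near $x$, $\beta_x=c\,g'_x$ on $S(TM')_x$ for some real constant $c$; $(M',S(TM'))$ is umbilical if near every point there are a null frame and a smooth function $f$ with $\beta=fg'$ on $S(TM')$. Denote by a tilde the objects formed with $(\widetilde g,\widetilde\nabla)$. Then $M'$ is lightlike for $\widetilde g$ and $S(TM')$ is a screen distribution for $\widetilde g$ as well. For every null frame $(\xi,N)$ for $g$ on an open set $U\subset M'$, the pair $(\widetilde\xi,\widetilde N)=(e^{-(\phi+\psi)/2}\xi,\;e^{-(\phi+\psi)/2}N)$ is a null frame for $\widetilde g$ on $U$, and on $S(TM')$ over $U$ $$\widetilde\beta=e^{(\phi+\psi)/2}\bigl(\beta-d\phi(N)\,g'\bigr),$$ where $\widetilde\beta(X,Y)=-\widetilde g(\widetilde\nabla_X\widetilde N,Y)$. Moreover, for each $x\in U$, $\beta_x$ is a multiple of $g'_x$ if and only if $\widetilde\beta_x$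 is a multiple of $\widetilde g'_x$, and there is a smooth function $f$ on $U$ with $\beta=fg'$ if and only if there is a smooth function $\widetilde f$ on $U$ with $\widetilde\beta=\widetilde f\,\widetilde g'$. Consequently a point of $M'$ is umbilical for $(g,\nabla)$ if and only if it is umbilical for $(\widetilde g,\widetilde\nabla)$, and $(M',S(TM'))$ is an umbilical lightlike hypersurface for $(g,\nabla)$ if and only if it is one for $(\widetilde g,\widetilde\nabla)$. -/

import Mathlib

open Bundle Manifold
open scoped ContDiff Topology

namespace LightlikeSWMT

noncomputable section

section Ambient

variable {E : Type*} [NormedAddCommGroup E] [NormedSpace ℝ E]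
  {M : Type*} [TopologicalSpace M] [ChartedSpace E M] [IsManifold 𝓘(ℝ, E) ∞ M]

variable (E M) in
/-- A smooth pseudo-Riemannian metric on `M`: a smooth field of symmetric nondegenerate bilinear
forms on the tangent spaces. -/
structure PseudoRiemannianMetric where
  /-- The bilinear form on each tangent space. -/
  val (x : M) : TangentSpace 𝓘(ℝ, E) x →L[ℝ] TangentSpace 𝓘(ℝ, E) x →L[ℝ] ℝ
  symm (x : M) (v w : TangentSpace 𝓘(ℝ, E) x) : val x v w = val x w v
  nondegenerate (x : M) (v : TangentSpace 𝓘(ℝ, E) x) (hv : ∀ w, val x v w = 0) : v = 0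
  contMDiff : ContMDiff 𝓘(ℝ, E) (𝓘(ℝ, E).prod 𝓘(ℝ, E →L[ℝ] E →L[ℝ] ℝ)) ∞
    (fun x ↦ TotalSpace.mk' (E →L[ℝ] E →L[ℝ] ℝ) x (val x))

variable (E M) in
/-- A smooth `1`-form on `M`. -/
structure OneForm where
  /-- The covector at each point. -/
  val (x : M) : TangentSpace 𝓘(ℝ, E) x →L[ℝ] ℝ
  contMDiff : ContMDiff 𝓘(ℝ, E) (𝓘(ℝ, E).prod 𝓘(ℝ, E →L[ℝ] ℝ)) ∞
    (fun x ↦ TotalSpace.mk' (E →L[ℝ] ℝ) x (val x))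

variable (E M) in
/-- A covariant derivative on the tangent bundle of `M`. The value of `∇_X Y` at `x` is
`D Y x (X x)`, in the order of arguments that Mathlib uses. -/
abbrev AffineConnection : Type _ :=
  CovariantDerivative 𝓘(ℝ, E) E (TangentSpace 𝓘(ℝ, E) : M → Type _)

/-- The differential `du` of a real function, as a field of covectors. -/
abbrev differential (u : M → ℝ) (x : M) : TangentSpace 𝓘(ℝ, E) x →L[ℝ] ℝ :=
  mvfderiv 𝓘(ℝ, E) u x

/-- A nondegenerate metric represents every covector by a vector. -/
theorem PseudoRiemannianMetric.exists_sharp [FiniteDimensional ℝ E]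
    (g : PseudoRiemannianMetric E M) (x : M) (a : TangentSpace 𝓘(ℝ, E) x →L[ℝ] ℝ) :
    ∃ w : TangentSpace 𝓘(ℝ, E) x, ∀ v, g.val x w v = a v := by
  have : FiniteDimensional ℝ (TangentSpace 𝓘(ℝ, E) x) := inferInstanceAs (FiniteDimensional ℝ E)
  let L : TangentSpace 𝓘(ℝ, E) x →ₗ[ℝ] Module.Dual ℝ (TangentSpace 𝓘(ℝ, E) x) :=
    { toFun := fun v ↦ (g.val x v).toLinearMap
      map_add' := fun v w ↦ by ext; simp
      map_smul' := fun c v ↦ by ext; simp }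
  have hL : Function.Injective L := by
    rw [injective_iff_map_eq_zero]
    intro v hv
    exact g.nondegenerate x v fun w ↦ by simpa [L] using LinearMap.congr_fun hv w
  have hs : Function.Surjective L :=
    (LinearMap.injective_iff_surjective_of_finrank_eq_finrank
      Subspace.dual_finrank_eq.symm).1 hL
  obtain ⟨w, hw⟩ := hs a.toLinearMap
  exact ⟨w, fun v ↦ by simpa [L] using LinearMap.congr_fun hw v⟩

/-- The gradient of `u` with respect to `g`: the vector field with `g(grad u, v) = du(v)`. -/
def PseudoRiemannianMetric.grad [FiniteDimensional ℝ E]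
    (g : PseudoRiemannianMetric E M) (u : M → ℝ) (x : M) : TangentSpace 𝓘(ℝ, E) x :=
  (g.exists_sharp x (differential u x)).choose

theorem PseudoRiemannianMetric.val_grad [FiniteDimensional ℝ E]
    (g : PseudoRiemannianMetric E M) (u : M → ℝ) (x : M) (v : TangentSpace 𝓘(ℝ, E) x) :
    g.val x (g.grad u x) v = differential u x v :=
  (g.exists_sharp x (differential u x)).choose_spec v

/-- `(∇_X g)(Y, Z)` at the point `x`. -/
def covDerivMetric (g : PseudoRiemannianMetric E M) (D : AffineConnection E M)
    (X Y Z : Π x : M, TangentSpace 𝓘(ℝ, E) x) (x : M) : ℝ :=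
  differential (fun y ↦ g.val y (Y y) (Z y)) x (X x)
    - g.val x (D Y x (X x)) (Z x) - g.val x (Y x) (D Z x (X x))

/-- The torsion `∇_X Y - ∇_Y X - [X, Y]` at the point `x`. -/
def torsionField (D : AffineConnection E M)
    (X Y : Π x : M, TangentSpace 𝓘(ℝ, E) x) (x : M) : TangentSpace 𝓘(ℝ, E) x :=
  D Y x (X x) - D X x (Y x) - VectorField.mlieBracket 𝓘(ℝ, E) X Y x

/-- `X` is a smooth vector field on `M`. -/
def IsSmoothField (X : Π x : M, TangentSpace 𝓘(ℝ, E) x) : Prop :=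
  ContMDiff 𝓘(ℝ, E) 𝓘(ℝ, E).tangent ∞ (fun x ↦ (⟨x, X x⟩ : TangentBundle 𝓘(ℝ, E) M))

/-- `(M, g, η, ∇)` is a semi-Weyl manifold admitting torsion. -/
def IsSemiWeylWithTorsion (g : PseudoRiemannianMetric E M) (η : OneForm E M)
    (D : AffineConnection E M) : Prop :=
  ∀ X Y Z : Π x : M, TangentSpace 𝓘(ℝ, E) x,
    IsSmoothField X → IsSmoothField Y → IsSmoothField Z → ∀ x : M,
    covDerivMetric g D X Y Z x + η.val x (X x) * g.val x (Y x) (Z x) =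
      covDerivMetric g D Y X Z x + η.val x (Y x) * g.val x (X x) (Z x)
        - g.val x (torsionField D X Y x) (Z x)

/-- The metric `e^u g`. -/
def PseudoRiemannianMetric.conformal (g : PseudoRiemannianMetric E M)
    (u : C^∞⟮𝓘(ℝ, E), M; ℝ⟯) : PseudoRiemannianMetric E M where
  val x := Real.exp (u x) • g.val x
  symm x v w := by simp [g.symm x v w]
  nondegenerate x v hv := g.nondegenerate x v fun w ↦ by
    simpa [Real.exp_ne_zero] using hv w
  contMDiff := by
    have h : ContMDiff 𝓘(ℝ, E) 𝓘(ℝ, ℝ) ∞ (fun x ↦ Real.exp (u x)) :=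
      Real.contDiff_exp.contMDiff.comp u.contMDiff
    exact h.smul_section g.contMDiff

/-- The connection `∇ + dφ ⊗ I + I ⊗ dφ - g ⊗ grad_g ψ`, that is,
`∇_X Y + dφ(X) Y + dφ(Y) X - g(X, Y) grad_g ψ`. -/
def conformalProjective [FiniteDimensional ℝ E] (D : AffineConnection E M)
    (g : PseudoRiemannianMetric E M) (φ ψ : C^∞⟮𝓘(ℝ, E), M; ℝ⟯) : AffineConnection E M where
  toFun Y x := D Y x + (differential φ x).smulRight (Y x)
    + differential φ x (Y x) • ContinuousLinearMap.id ℝ (TangentSpace 𝓘(ℝ, E) x)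
    - (g.val x (Y x)).smulRight (g.grad ψ x)
  isCovariantDerivativeOnUniv :=
    { add := by
        intro Y Y' x hY hY' _
        rw [D.isCovariantDerivativeOnUniv.add hY hY']
        ext v
        simp
        module
      leibniz := by
        intro Y f x hY hf _
        rw [D.isCovariantDerivativeOnUniv.leibniz hY hf]
        ext v
        simp
        module }

theorem conformalProjective_apply [FiniteDimensional ℝ E] (D : AffineConnection E M)
    (g : PseudoRiemannianMetric E M) (φ ψ : C^∞⟮𝓘(ℝ, E), M; ℝ⟯)
    (X Y : Π x : M, TangentSpace 𝓘(ℝ, E) x) (x : M) :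
    conformalProjective D g φ ψ Y x (X x) =
      D Y x (X x) + differential φ x (X x) • Y x + differential φ x (Y x) • X x
        - g.val x (X x) (Y x) • g.grad ψ x := by
  simp [conformalProjective, g.symm x (X x) (Y x)]

end Ambient

section Hypersurface

variable {E : Type*} [NormedAddCommGroup E] [NormedSpace ℝ E]
  {M : Type*} [TopologicalSpace M] [ChartedSpace E M] [IsManifold 𝓘(ℝ, E) ∞ M]
  {E' : Type*} [NormedAddCommGroup E'] [NormedSpace ℝ E']
  {M' : Type*} [TopologicalSpace M'] [ChartedSpace E' M'] [IsManifold 𝓘(ℝ, E') ∞ M']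

/-- The induced tensor `g' = ι^* g` on `M'`. -/
def inducedForm (g : PseudoRiemannianMetric E M) (ι : M' → M) (x : M')
    (X Y : TangentSpace 𝓘(ℝ, E') x) : ℝ :=
  g.val (ι x) (mfderiv 𝓘(ℝ, E') 𝓘(ℝ, E) ι x X) (mfderiv 𝓘(ℝ, E') 𝓘(ℝ, E) ι x Y)

/-- The radical of `g'` at the point `x` of `M'`. -/
def radical (g : PseudoRiemannianMetric E M) (ι : M' → M) (x : M') :
    Submodule ℝ (TangentSpace 𝓘(ℝ, E') x) where
  carrier := {v | ∀ w, inducedForm g ι x v w = 0}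
  add_mem' {a b} ha hb w := by
    have ha' := ha w
    have hb' := hb w
    simp only [inducedForm] at ha' hb' ⊢
    simp [ha', hb']
  zero_mem' w := by simp [inducedForm]
  smul_mem' c v hv w := by
    have hv' := hv w
    simp only [inducedForm] at hv' ⊢
    simp [hv']

/-- The immersed hypersurface `ι : M' → M` is lightlike: `g'` is degenerate at every point. -/
def IsLightlike (g : PseudoRiemannianMetric E M) (ι : M' → M) : Prop :=
  ∀ x : M', radical (E' := E') g ι x ≠ ⊥

/-- `X` is smooth on `U` as a vector field on `M'`. -/
def IsSmoothFieldOn (U : Set M') (X : Π x : M', TangentSpace 𝓘(ℝ, E') x) : Prop :=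
  ContMDiffOn 𝓘(ℝ, E') 𝓘(ℝ, E').tangent ∞
    (fun x ↦ (⟨x, X x⟩ : TangentBundle 𝓘(ℝ, E') M')) U

/-- `N` is smooth on `U` as a section of `TM` along `ι`. -/
def IsSmoothSectionAlongOn (ι : M' → M) (U : Set M')
    (N : Π x : M', TangentSpace 𝓘(ℝ, E) (ι x)) : Prop :=
  ContMDiffOn 𝓘(ℝ, E') 𝓘(ℝ, E).tangent ∞
    (fun x ↦ (⟨ι x, N x⟩ : TangentBundle 𝓘(ℝ, E) M)) U

/-- `S` is a smooth distribution on `M'`: near each point it is spanned by finitely many smooth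
pointwise linearly independent vector fields. -/
def IsSmoothDistribution (S : Π x : M', Submodule ℝ (TangentSpace 𝓘(ℝ, E') x)) : Prop :=
  ∀ x₀ : M', ∃ U : Set M', IsOpen U ∧ x₀ ∈ U ∧
    ∃ (r : ℕ) (e : Fin r → Π x : M', TangentSpace 𝓘(ℝ, E') x),
      (∀ i, IsSmoothFieldOn U (e i)) ∧
      ∀ x ∈ U, LinearIndependent ℝ (fun i ↦ e i x) ∧
        Submodule.span ℝ (Set.range fun i ↦ e i x) = S x

/-- `S` is a screen distribution: a smooth distribution complementary to the radical of `g'`. -/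
def IsScreenDistribution (g : PseudoRiemannianMetric E M) (ι : M' → M)
    (S : Π x : M', Submodule ℝ (TangentSpace 𝓘(ℝ, E') x)) : Prop :=
  IsSmoothDistribution S ∧ ∀ x : M', IsCompl (S x) (radical g ι x)

/-- `S` is integrable (in Frobenius' sense): the bracket of two local sections of `S` is a
section of `S`. -/
def IsIntegrable (S : Π x : M', Submodule ℝ (TangentSpace 𝓘(ℝ, E') x)) : Prop :=
  ∀ (U : Set M') (X Y : Π x : M', TangentSpace 𝓘(ℝ, E') x), IsOpen U →
    IsSmoothFieldOn U X → IsSmoothFieldOn U Y →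
    (∀ x ∈ U, X x ∈ S x) → (∀ x ∈ U, Y x ∈ S x) →
    ∀ x ∈ U, VectorField.mlieBracket 𝓘(ℝ, E') X Y x ∈ S x

/-- The pair `(ξ, N)` on the open set `U` of `M'`: `ξ` is a local basis of the radical
distribution and `N` is the section of the lightlike transversal bundle with respect to `S`
normalized by `g(N, ξ) = 1`. (That `ξ` does not vanish follows from this normalization.) -/
structure IsNullFrame (g : PseudoRiemannianMetric E M) (ι : M' → M)
    (S : Π x : M', Submodule ℝ (TangentSpace 𝓘(ℝ, E') x)) (U : Set M')
    (ξ : Π x : M', TangentSpace 𝓘(ℝ, E') x) (N : Π x : M', TangentSpace 𝓘(ℝ, E) (ι x)) :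
    Prop where
  smooth_radical : IsSmoothFieldOn U ξ
  mem_radical : ∀ x ∈ U, ξ x ∈ radical g ι x
  smooth_transversal : IsSmoothSectionAlongOn (E' := E') ι U N
  normalized : ∀ x ∈ U, g.val (ι x) (N x) (mfderiv 𝓘(ℝ, E') 𝓘(ℝ, E) ι x (ξ x)) = 1
  null : ∀ x ∈ U, g.val (ι x) (N x) (N x) = 0
  orthogonal : ∀ x ∈ U, ∀ W ∈ S x,
    g.val (ι x) (N x) (mfderiv 𝓘(ℝ, E') 𝓘(ℝ, E) ι x W) = 0

/-- The derivative `∇_v N` of a section `N` of `TM` along `ι : M' → M`, for `v` tangent to `M'`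
at `x`, that is, the pullback of `∇` by `ι`. In the local frame `(e_i)` of `TM` that the standard
trivialization at `ι x` gives, `N = ∑ N^i e_i ∘ ι` and `∇_v N = ∑ dN^i(v) e_i + N^i ∇_{dι v} e_i`;
here `FiberBundle.extend` is the field on `M` with constant components in this frame. -/
def covDerivAlong (D : AffineConnection E M) (ι : M' → M)
    (N : Π x : M', TangentSpace 𝓘(ℝ, E) (ι x)) (x : M') (v : TangentSpace 𝓘(ℝ, E') x) :
    TangentSpace 𝓘(ℝ, E) (ι x) :=
  (trivializationAt E (TangentSpace 𝓘(ℝ, E)) (ι x)).symmL ℝ (ι x)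
      (mvfderiv 𝓘(ℝ, E')
        (fun y ↦ ((trivializationAt E (TangentSpace 𝓘(ℝ, E)) (ι x))
          (⟨ι y, N y⟩ : TangentBundle 𝓘(ℝ, E) M)).2) x v)
    + D (FiberBundle.extend E (N x)) (ι x) (mfderiv 𝓘(ℝ, E') 𝓘(ℝ, E) ι x v)

/-- `β(X, Y) = -g(∇_X N, Y)`, for `X`, `Y` tangent to `M'` at `x`. -/
def beta (g : PseudoRiemannianMetric E M) (D : AffineConnection E M) (ι : M' → M)
    (N : Π x : M', TangentSpace 𝓘(ℝ, E) (ι x)) (x : M') (X Y : TangentSpace 𝓘(ℝ, E') x) : ℝ :=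
  - g.val (ι x) (covDerivAlong D ι N x X) (mfderiv 𝓘(ℝ, E') 𝓘(ℝ, E) ι x Y)

/-- With respect to the transversal section `N`, `β_x = c g'_x` on `S_x`. -/
def IsProportionalAt (g : PseudoRiemannianMetric E M) (D : AffineConnection E M) (ι : M' → M)
    (S : Π x : M', Submodule ℝ (TangentSpace 𝓘(ℝ, E') x))
    (N : Π x : M', TangentSpace 𝓘(ℝ, E) (ι x)) (x : M') (c : ℝ) : Prop :=
  ∀ X ∈ S x, ∀ Y ∈ S x, beta g D ι N x X Y = c * inducedForm g ι x X Y

/-- With respect to the transversal section `N` on `U`, there is a smooth function `f` on `U` with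
`β = f g'` on `S`. -/
def IsUmbilicalOn (g : PseudoRiemannianMetric E M) (D : AffineConnection E M) (ι : M' → M)
    (S : Π x : M', Submodule ℝ (TangentSpace 𝓘(ℝ, E') x)) (U : Set M')
    (N : Π x : M', TangentSpace 𝓘(ℝ, E) (ι x)) : Prop :=
  ∃ f : M' → ℝ, ContMDiffOn 𝓘(ℝ, E') 𝓘(ℝ, ℝ) ∞ f U ∧
    ∀ x ∈ U, IsProportionalAt g D ι S N x (f x)

/-- `x` is an umbilical point of `(M', S)`. -/
def IsUmbilicalPoint (g : PseudoRiemannianMetric E M) (D : AffineConnection E M) (ι : M' → M)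
    (S : Π x : M', Submodule ℝ (TangentSpace 𝓘(ℝ, E') x)) (x : M') : Prop :=
  ∃ (U : Set M') (ξ : Π x : M', TangentSpace 𝓘(ℝ, E') x)
    (N : Π x : M', TangentSpace 𝓘(ℝ, E) (ι x)), IsOpen U ∧ x ∈ U ∧
    IsNullFrame g ι S U ξ N ∧ ∃ c : ℝ, IsProportionalAt g D ι S N x c

/-- `(M', S)` is an umbilical lightlike hypersurface. As `N`, hence `β`, exists only locally and
up to a nowhere zero factor, `β = f g'` with smooth `f` is required near each point. -/
def IsUmbilical (g : PseudoRiemannianMetric E M) (D : AffineConnection E M) (ι : M' → M)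
    (S : Π x : M', Submodule ℝ (TangentSpace 𝓘(ℝ, E') x)) : Prop :=
  ∀ x : M', ∃ (U : Set M') (ξ : Π x : M', TangentSpace 𝓘(ℝ, E') x)
    (N : Π x : M', TangentSpace 𝓘(ℝ, E) (ι x)), IsOpen U ∧ x ∈ U ∧
    IsNullFrame g ι S U ξ N ∧ IsUmbilicalOn g D ι S U N

end Hypersurface

end

end LightlikeSWMT

open LightlikeSWMT

namespace LightlikeSWMT

section

variable {E : Type*} [NormedAddCommGroup E] [NormedSpace ℝ E]
  {M : Type*} [TopologicalSpace M] [ChartedSpace E M]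
  {E' : Type*} [NormedAddCommGroup E'] [NormedSpace ℝ E']
  {M' : Type*} [TopologicalSpace M'] [ChartedSpace E' M']

/-! Put `u = φ + ψ` and `f = e^{-u/2}`. Expanding `∇̃_X (f N)` gives `f ∇_X N`, two multiples of `N`
(from `df(X)` and `dφ(X)`), a multiple of `grad ψ` with factor `g(X, N)`, and `f dφ(N) X`. For `X`,
`Y` in the screen, `g(N, Y) = 0` removes the multiples of `N` and `g(X, N) = 0` removes the
gradient. Only `f dφ(N) X` is new, and `e^u f = e^{u/2}` gives the law of change,
`IsNullFrame.beta_conformalProjective`. The correction to `β` is thus itself a multiple of `g'`, so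
a factor `c` of `β` becomes `e^{-u/2} (c - dφ(N))`. This is an invertible affine map of `c` whose
coefficients are smooth in `x`, so umbilicity transfers both ways for a fixed null frame. Umbilicity
asks for some null frame, so the converse also needs every null frame of `e^u g` to be a rescaled
null frame of `g`: `IsNullFrame.exists_of_conformal`. -/

theorem contMDiff_exp_neg_half (u : C^∞⟮𝓘(ℝ, E), M; ℝ⟯) {ι : M' → M}
    (hι : ContMDiff 𝓘(ℝ, E') 𝓘(ℝ, E) ∞ ι) :
    ContMDiff 𝓘(ℝ, E') 𝓘(ℝ, ℝ) ∞ (fun x ↦ Real.exp (-(u (ι x)) / 2)) := by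
  have h : ContDiff ℝ ∞ (fun t : ℝ ↦ Real.exp (-t / 2)) := by fun_prop
  exact h.contMDiff.comp (u.contMDiff.comp hι)

/-! ### Sections of `TM` along `ι` and their covariant derivative -/

variable [IsManifold 𝓘(ℝ, E) ∞ M]

theorem trivializationAt_smul_snd (p : M) {y : M}
    (hy : y ∈ (trivializationAt E (TangentSpace 𝓘(ℝ, E) : M → Type _) p).baseSet) (c : ℝ)
    (v : TangentSpace 𝓘(ℝ, E) y) :
    ((trivializationAt E (TangentSpace 𝓘(ℝ, E)) p)
      (⟨y, c • v⟩ : TangentBundle 𝓘(ℝ, E) M)).2 =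
    c • ((trivializationAt E (TangentSpace 𝓘(ℝ, E)) p)
      (⟨y, v⟩ : TangentBundle 𝓘(ℝ, E) M)).2 :=
  ((trivializationAt E (TangentSpace 𝓘(ℝ, E)) p).linear ℝ hy).2 c v

/-- Near `x`, the coordinates of `f N` in the trivialization at `ι x` are `f` times those of `N`. -/
theorem eventually_trivializationAt_smul_snd {ι : M' → M} {x : M'} (hι : ContinuousAt ι x)
    (f : M' → ℝ) (N : Π x : M', TangentSpace 𝓘(ℝ, E) (ι x)) :
    (fun y ↦ ((trivializationAt E (TangentSpace 𝓘(ℝ, E)) (ι x))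
      (⟨ι y, f y • N y⟩ : TangentBundle 𝓘(ℝ, E) M)).2) =ᶠ[𝓝 x]
    fun y ↦ f y • ((trivializationAt E (TangentSpace 𝓘(ℝ, E)) (ι x))
      (⟨ι y, N y⟩ : TangentBundle 𝓘(ℝ, E) M)).2 := by
  filter_upwards [hι.preimage_mem_nhds
    ((trivializationAt E (TangentSpace 𝓘(ℝ, E) : M → Type _) (ι x)).open_baseSet.mem_nhds
      (FiberBundle.mem_baseSet_trivializationAt' (ι x)))] with y hy
  exact trivializationAt_smul_snd (ι x) hy (f y) (N y)

theorem IsSmoothSectionAlongOn.smul {ι : M' → M} {U : Set M'} (hU : IsOpen U)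
    {N : Π x : M', TangentSpace 𝓘(ℝ, E) (ι x)} (hN : IsSmoothSectionAlongOn (E' := E') ι U N)
    {f : M' → ℝ} (hf : ContMDiffOn 𝓘(ℝ, E') 𝓘(ℝ, ℝ) ∞ f U) :
    IsSmoothSectionAlongOn (E' := E') ι U (fun x ↦ f x • N x) := by
  intro x hx
  have h := (hN x hx).contMDiffAt (hU.mem_nhds hx)
  have h' := contMDiffAt_totalSpace.1 h
  refine ContMDiffAt.contMDiffWithinAt (contMDiffAt_totalSpace.2 ⟨h'.1, ?_⟩)
  exact (((hf x hx).contMDiffAt (hU.mem_nhds hx)).smul h'.2).congr_of_eventuallyEq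
    (eventually_trivializationAt_smul_snd h'.1.continuousAt f N)

/-- The Leibniz rule for the derivative of a section of `TM` along `ι`. -/
theorem covDerivAlong_smul (D : AffineConnection E M) {ι : M' → M}
    {N : Π x : M', TangentSpace 𝓘(ℝ, E) (ι x)} {f : M' → ℝ} {x : M'}
    (hN : MDifferentiableAt 𝓘(ℝ, E') 𝓘(ℝ, E).tangent
      (fun x ↦ (⟨ι x, N x⟩ : TangentBundle 𝓘(ℝ, E) M)) x)
    (hf : MDifferentiableAt 𝓘(ℝ, E') 𝓘(ℝ, ℝ) f x) (v : TangentSpace 𝓘(ℝ, E') x) :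
    covDerivAlong D ι (fun y ↦ f y • N y) x v =
      f x • covDerivAlong D ι N x v + differential f x v • N x := by
  have hN' := (mdifferentiableAt_totalSpace _ _).1 hN
  have hmem : ι x ∈ (trivializationAt E (TangentSpace 𝓘(ℝ, E) : M → Type _) (ι x)).baseSet :=
    FiberBundle.mem_baseSet_trivializationAt' (ι x)
  have hmd (w : TangentSpace 𝓘(ℝ, E) (ι x)) := FiberBundle.mdifferentiableAt_extend 𝓘(ℝ, E) E w
  -- The extension has constant components in the trivialization at `ι x`, so it is linear in the
  -- prescribed vector, but only over the base set; locality of `D` then suffices.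
  have hext : ∀ᶠ y in 𝓝 (ι x), FiberBundle.extend E (f x • N x) y =
      (f x • (FiberBundle.extend E (N x) : Π y : M, TangentSpace 𝓘(ℝ, E) y)) y := by
    filter_upwards [(trivializationAt E (TangentSpace 𝓘(ℝ, E) : M → Type _)
      (ι x)).open_baseSet.mem_nhds hmem] with y hy
    simp only [FiberBundle.extend, Pi.smul_apply]
    rw [trivializationAt_smul_snd (ι x) hmem, ← Trivialization.symmL_apply (R := ℝ) _ hy,
      ← Trivialization.symmL_apply (R := ℝ) _ hy, map_smul]
  have hDext : D (FiberBundle.extend E (f x • N x)) (ι x) =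
      f x • D (FiberBundle.extend E (N x)) (ι x) := by
    rw [← D.isCovariantDerivativeOnUniv.smul_const (f x) (hmd (N x))]
    exact D.isCovariantDerivativeOnUniv.congr_of_eventuallyEq (hmd _)
      (mdifferentiableAt_const.smul_section (hmd (N x))) Filter.univ_mem hext
  have hcoord := eventually_trivializationAt_smul_snd hN'.1.continuousAt f N
  -- The product rule applies to the coordinates of `N`, which are vectors of the fixed space `E`.
  have hd : mvfderiv 𝓘(ℝ, E') (fun y ↦ ((trivializationAt E (TangentSpace 𝓘(ℝ, E)) (ι x))
      (⟨ι y, f y • N y⟩ : TangentBundle 𝓘(ℝ, E) M)).2) x v =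
      f x • mvfderiv 𝓘(ℝ, E') (fun y ↦ ((trivializationAt E (TangentSpace 𝓘(ℝ, E)) (ι x))
        (⟨ι y, N y⟩ : TangentBundle 𝓘(ℝ, E) M)).2) x v
      + differential f x v • ((trivializationAt E (TangentSpace 𝓘(ℝ, E)) (ι x))
        (⟨ι x, N x⟩ : TangentBundle 𝓘(ℝ, E) M)).2 := by
    have h1 := DFunLike.congr_fun (mvfderiv_fun_smul hf hN'.2) v
    simp only [mvfderiv, ContinuousLinearMap.comp_apply] at h1 ⊢
    rw [hcoord.mfderiv_eq]
    exact h1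
  have hsymm : (trivializationAt E (TangentSpace 𝓘(ℝ, E)) (ι x)).symmL ℝ (ι x)
      ((trivializationAt E (TangentSpace 𝓘(ℝ, E)) (ι x))
        (⟨ι x, N x⟩ : TangentBundle 𝓘(ℝ, E) M)).2 = N x := by
    rw [Trivialization.symmL_apply _ hmem]
    exact (trivializationAt E (TangentSpace 𝓘(ℝ, E)) (ι x)).symm_apply_apply_mk hmem (N x)
  unfold covDerivAlong
  rw [hd, hDext, map_add, map_smul, map_smul, hsymm]
  simp only [_root_.smul_apply]
  module

/-! ### Effect of the change on the connection, the metric and the radical -/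

/-- The coordinate derivative term does not involve the connection, and the difference of the two
connections is tensorial, so it sees only the value `N x` of the extension. Hence `N` need not be
differentiable here. -/
theorem covDerivAlong_conformalProjective [FiniteDimensional ℝ E] (D : AffineConnection E M)
    (g : PseudoRiemannianMetric E M) (φ ψ : C^∞⟮𝓘(ℝ, E), M; ℝ⟯) (ι : M' → M)
    (N : Π x : M', TangentSpace 𝓘(ℝ, E) (ι x)) (x : M') (v : TangentSpace 𝓘(ℝ, E') x) :
    covDerivAlong (conformalProjective D g φ ψ) ι N x v =
      covDerivAlong D ι N x v
        + differential φ (ι x) (mfderiv 𝓘(ℝ, E') 𝓘(ℝ, E) ι x v) • N x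
        + differential φ (ι x) (N x) • mfderiv 𝓘(ℝ, E') 𝓘(ℝ, E) ι x v
        - g.val (ι x) (N x) (mfderiv 𝓘(ℝ, E') 𝓘(ℝ, E) ι x v) • g.grad ψ (ι x) := by
  unfold covDerivAlong
  simp only [conformalProjective, _root_.add_apply, _root_.sub_apply,
    ContinuousLinearMap.smulRight_apply,
    _root_.smul_apply, ContinuousLinearMap.id_apply, FiberBundle.extend_apply_self]
  abel

theorem PseudoRiemannianMetric.conformal_val (g : PseudoRiemannianMetric E M)
    (u : C^∞⟮𝓘(ℝ, E), M; ℝ⟯) (x : M) (v w : TangentSpace 𝓘(ℝ, E) x) :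
    (g.conformal u).val x v w = Real.exp (u x) * g.val x v w := rfl

/-- This lets the forward rescaling of null frames, applied with `-u`, serve as its own inverse. -/
theorem PseudoRiemannianMetric.conformal_conformal_neg (g : PseudoRiemannianMetric E M)
    (u : C^∞⟮𝓘(ℝ, E), M; ℝ⟯) : (g.conformal u).conformal (-u) = g := by
  have h : ((g.conformal u).conformal (-u)).val = g.val := by
    funext x
    ext v w
    rw [conformal_val, conformal_val, ← mul_assoc, ← Real.exp_add]
    simp
  cases g
  exact (PseudoRiemannianMetric.mk.injEq ..).mpr h

theorem inducedForm_conformal (g : PseudoRiemannianMetric E M) (u : C^∞⟮𝓘(ℝ, E), M; ℝ⟯)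
    (ι : M' → M) (x : M') (X Y : TangentSpace 𝓘(ℝ, E') x) :
    inducedForm (g.conformal u) ι x X Y = Real.exp (u (ι x)) * inducedForm g ι x X Y := rfl

theorem radical_conformal (g : PseudoRiemannianMetric E M) (u : C^∞⟮𝓘(ℝ, E), M; ℝ⟯)
    (ι : M' → M) (x : M') :
    radical (E' := E') (g.conformal u) ι x = radical g ι x := by
  ext v
  change (∀ w, inducedForm (g.conformal u) ι x v w = 0) ↔ ∀ w, inducedForm g ι x v w = 0
  simp [inducedForm_conformal, Real.exp_ne_zero]

/-- The differential of a smooth function, evaluated on a smooth section along `ι`, is smooth. -/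
theorem IsSmoothSectionAlongOn.contMDiffOn_differential {ι : M' → M} {U : Set M'}
    {N : Π x : M', TangentSpace 𝓘(ℝ, E) (ι x)} (hN : IsSmoothSectionAlongOn (E' := E') ι U N)
    (φ : C^∞⟮𝓘(ℝ, E), M; ℝ⟯) :
    ContMDiffOn 𝓘(ℝ, E') 𝓘(ℝ, ℝ) ∞ (fun x ↦ differential φ (ι x) (N x)) U := by
  -- The function is the fibre component of the tangent map of `φ` composed with `N`, as a map into
  -- `TM`.
  have h : ContMDiff 𝓘(ℝ, E).tangent 𝓘(ℝ, ℝ).tangent ∞ (tangentMap 𝓘(ℝ, E) 𝓘(ℝ, ℝ) φ) :=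
    φ.contMDiff.contMDiff_tangentMap (by simp)
  exact (contMDiff_snd_tangentBundle_modelSpace ℝ 𝓘(ℝ, ℝ)).comp_contMDiffOn
    (h.comp_contMDiffOn hN)

/-! ### Null frames and the law of change of `β` -/

variable [IsManifold 𝓘(ℝ, E') ∞ M']

theorem IsNullFrame.conformal {g : PseudoRiemannianMetric E M} {ι : M' → M}
    {S : Π x : M', Submodule ℝ (TangentSpace 𝓘(ℝ, E') x)} {U : Set M'}
    {ξ : Π x : M', TangentSpace 𝓘(ℝ, E') x} {N : Π x : M', TangentSpace 𝓘(ℝ, E) (ι x)}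
    (h : IsNullFrame g ι S U ξ N) (hU : IsOpen U) (hι : ContMDiff 𝓘(ℝ, E') 𝓘(ℝ, E) ∞ ι)
    (u : C^∞⟮𝓘(ℝ, E), M; ℝ⟯) :
    IsNullFrame (g.conformal u) ι S U (fun x ↦ Real.exp (-(u (ι x)) / 2) • ξ x)
      (fun x ↦ Real.exp (-(u (ι x)) / 2) • N x) where
  smooth_radical :=
    ((contMDiff_exp_neg_half u hι).contMDiffOn (s := U)).smul_section h.smooth_radical
  mem_radical x hx := by
    rw [radical_conformal]
    exact Submodule.smul_mem _ _ (h.mem_radical x hx)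
  smooth_transversal := h.smooth_transversal.smul hU (contMDiff_exp_neg_half u hι).contMDiffOn
  normalized x hx := by
    -- The two factors `e^{-u/2}`, one from `ξ` and one from `N`, cancel the `e^u` of the metric.
    simp only [PseudoRiemannianMetric.conformal_val, map_smul, _root_.smul_apply,
      h.normalized x hx, smul_eq_mul, mul_one, ← Real.exp_add]
    rw [← Real.exp_zero]
    congr 1
    ring
  null x hx := by
    simp [PseudoRiemannianMetric.conformal_val, h.null x hx]
  orthogonal x hx W hW := by
    simp [PseudoRiemannianMetric.conformal_val, h.orthogonal x hx W hW]

/-- The law of change of `β` under a conformal-projective change. -/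
theorem IsNullFrame.beta_conformalProjective [FiniteDimensional ℝ E]
    {g : PseudoRiemannianMetric E M} {ι : M' → M}
    {S : Π x : M', Submodule ℝ (TangentSpace 𝓘(ℝ, E') x)} {U : Set M'}
    {ξ : Π x : M', TangentSpace 𝓘(ℝ, E') x} {N : Π x : M', TangentSpace 𝓘(ℝ, E) (ι x)}
    (h : IsNullFrame g ι S U ξ N) (hU : IsOpen U) (hι : ContMDiff 𝓘(ℝ, E') 𝓘(ℝ, E) ∞ ι)
    (D : AffineConnection E M) (φ ψ : C^∞⟮𝓘(ℝ, E), M; ℝ⟯) {x : M'} (hx : x ∈ U)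
    {X Y : TangentSpace 𝓘(ℝ, E') x} (hX : X ∈ S x) (hY : Y ∈ S x) :
    beta (g.conformal (φ + ψ)) (conformalProjective D g φ ψ) ι
        (fun x ↦ Real.exp (-((φ + ψ) (ι x)) / 2) • N x) x X Y =
      Real.exp ((φ + ψ) (ι x) / 2) *
        (beta g D ι N x X Y - differential φ (ι x) (N x) * inducedForm g ι x X Y) := by
  have hN : MDifferentiableAt 𝓘(ℝ, E') 𝓘(ℝ, E).tangent
      (fun x ↦ (⟨ι x, N x⟩ : TangentBundle 𝓘(ℝ, E) M)) x :=
    ((h.smooth_transversal x hx).contMDiffAt (hU.mem_nhds hx)).mdifferentiableAt (by simp)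
  have hf := ((contMDiff_exp_neg_half (φ + ψ) hι).contMDiffAt (x := x)).mdifferentiableAt
    (by simp)
  have hexp : Real.exp ((φ + ψ) (ι x)) * Real.exp (-((φ + ψ) (ι x)) / 2) =
      Real.exp ((φ + ψ) (ι x) / 2) := by
    rw [← Real.exp_add]
    congr 1
    ring
  unfold beta
  -- Orthogonality of `N` to `X` kills the `grad ψ` term here; orthogonality to `Y`, used in the
  -- next step, kills both multiples of `N`.
  rw [covDerivAlong_smul _ hN hf, covDerivAlong_conformalProjective,
    PseudoRiemannianMetric.conformal_val, h.orthogonal x hx X hX]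
  simp only [map_add, map_smul, _root_.add_apply, _root_.smul_apply,
    smul_eq_mul, h.orthogonal x hx Y hY, zero_smul, mul_zero, sub_zero, add_zero, inducedForm]
  rw [← hexp]
  ring

/-! ### Transfer of umbilicity -/

/-- Along with `β`, the proportionality factor of `β` and `g'` changes. -/
theorem IsNullFrame.isProportionalAt_conformalProjective_iff [FiniteDimensional ℝ E]
    {g : PseudoRiemannianMetric E M} {ι : M' → M}
    {S : Π x : M', Submodule ℝ (TangentSpace 𝓘(ℝ, E') x)} {U : Set M'}
    {ξ : Π x : M', TangentSpace 𝓘(ℝ, E') x} {N : Π x : M', TangentSpace 𝓘(ℝ, E) (ι x)}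
    (h : IsNullFrame g ι S U ξ N) (hU : IsOpen U) (hι : ContMDiff 𝓘(ℝ, E') 𝓘(ℝ, E) ∞ ι)
    (D : AffineConnection E M) (φ ψ : C^∞⟮𝓘(ℝ, E), M; ℝ⟯) {x : M'} (hx : x ∈ U) (c : ℝ) :
    IsProportionalAt (g.conformal (φ + ψ)) (conformalProjective D g φ ψ) ι S
        (fun x ↦ Real.exp (-((φ + ψ) (ι x)) / 2) • N x) x
        (Real.exp (-((φ + ψ) (ι x)) / 2) * (c - differential φ (ι x) (N x))) ↔
      IsProportionalAt g D ι S N x c := by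
  have hexp : Real.exp (-((φ + ψ) (ι x)) / 2) * Real.exp ((φ + ψ) (ι x)) =
      Real.exp ((φ + ψ) (ι x) / 2) := by
    rw [← Real.exp_add]
    congr 1
    ring
  refine forall₂_congr fun X hX ↦ forall₂_congr fun Y hY ↦ ?_
  rw [h.beta_conformalProjective hU hι D φ ψ hx hX hY, inducedForm_conformal]
  have hr : Real.exp (-((φ + ψ) (ι x)) / 2) * (c - differential φ (ι x) (N x)) *
      (Real.exp ((φ + ψ) (ι x)) * inducedForm g ι x X Y) =
      Real.exp ((φ + ψ) (ι x) / 2) *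
        ((c - differential φ (ι x) (N x)) * inducedForm g ι x X Y) := by
    rw [← hexp]
    ring
  rw [hr, mul_right_inj' (Real.exp_ne_zero _), sub_mul, sub_left_inj]

/-- Solves `c = e^{-u/2} (c₀ - dφ(N))` for `c₀`, so that an arbitrary factor on the changed side can
be fed to the preceding equivalence. -/
theorem IsNullFrame.isProportionalAt_of_conformalProjective [FiniteDimensional ℝ E]
    {g : PseudoRiemannianMetric E M} {ι : M' → M}
    {S : Π x : M', Submodule ℝ (TangentSpace 𝓘(ℝ, E') x)} {U : Set M'}
    {ξ : Π x : M', TangentSpace 𝓘(ℝ, E') x} {N : Π x : M', TangentSpace 𝓘(ℝ, E) (ι x)}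
    (h : IsNullFrame g ι S U ξ N) (hU : IsOpen U) (hι : ContMDiff 𝓘(ℝ, E') 𝓘(ℝ, E) ∞ ι)
    (D : AffineConnection E M) (φ ψ : C^∞⟮𝓘(ℝ, E), M; ℝ⟯) {x : M'} (hx : x ∈ U) {c : ℝ}
    (hc : IsProportionalAt (g.conformal (φ + ψ)) (conformalProjective D g φ ψ) ι S
        (fun x ↦ Real.exp (-((φ + ψ) (ι x)) / 2) • N x) x c) :
    IsProportionalAt g D ι S N x
      ((Real.exp (-((φ + ψ) (ι x)) / 2))⁻¹ * c + differential φ (ι x) (N x)) := by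
  rw [← h.isProportionalAt_conformalProjective_iff hU hι D φ ψ hx, add_sub_cancel_right,
    mul_inv_cancel_left₀ (Real.exp_ne_zero _)]
  exact hc

theorem IsNullFrame.exists_isProportionalAt_conformalProjective_iff [FiniteDimensional ℝ E]
    {g : PseudoRiemannianMetric E M} {ι : M' → M}
    {S : Π x : M', Submodule ℝ (TangentSpace 𝓘(ℝ, E') x)} {U : Set M'}
    {ξ : Π x : M', TangentSpace 𝓘(ℝ, E') x} {N : Π x : M', TangentSpace 𝓘(ℝ, E) (ι x)}
    (h : IsNullFrame g ι S U ξ N) (hU : IsOpen U) (hι : ContMDiff 𝓘(ℝ, E') 𝓘(ℝ, E) ∞ ι)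
    (D : AffineConnection E M) (φ ψ : C^∞⟮𝓘(ℝ, E), M; ℝ⟯) {x : M'} (hx : x ∈ U) :
    (∃ c : ℝ, IsProportionalAt g D ι S N x c) ↔
      ∃ c : ℝ, IsProportionalAt (g.conformal (φ + ψ)) (conformalProjective D g φ ψ) ι S
        (fun x ↦ Real.exp (-((φ + ψ) (ι x)) / 2) • N x) x c :=
  ⟨fun ⟨c, hc⟩ ↦ ⟨_, (h.isProportionalAt_conformalProjective_iff hU hι D φ ψ hx c).2 hc⟩,
    fun ⟨_, hc⟩ ↦ ⟨_, h.isProportionalAt_of_conformalProjective hU hι D φ ψ hx hc⟩⟩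

theorem IsNullFrame.isUmbilicalOn_conformalProjective_iff [FiniteDimensional ℝ E]
    {g : PseudoRiemannianMetric E M} {ι : M' → M}
    {S : Π x : M', Submodule ℝ (TangentSpace 𝓘(ℝ, E') x)} {U : Set M'}
    {ξ : Π x : M', TangentSpace 𝓘(ℝ, E') x} {N : Π x : M', TangentSpace 𝓘(ℝ, E) (ι x)}
    (h : IsNullFrame g ι S U ξ N) (hU : IsOpen U) (hι : ContMDiff 𝓘(ℝ, E') 𝓘(ℝ, E) ∞ ι)
    (D : AffineConnection E M) (φ ψ : C^∞⟮𝓘(ℝ, E), M; ℝ⟯) :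
    IsUmbilicalOn g D ι S U N ↔
      IsUmbilicalOn (g.conformal (φ + ψ)) (conformalProjective D g φ ψ) ι S U
        (fun x ↦ Real.exp (-((φ + ψ) (ι x)) / 2) • N x) := by
  have hexp := (contMDiff_exp_neg_half (φ + ψ) hι).contMDiffOn (s := U)
  have hφ := h.smooth_transversal.contMDiffOn_differential φ
  constructor
  · rintro ⟨f, hf, hp⟩
    -- The smoothness proof determines the witness `e^{-u/2} (f - dφ(N))`; the other direction uses
    -- the inverse affine expression.
    exact ⟨_, hexp.mul (hf.sub hφ),
      fun x hx ↦ (h.isProportionalAt_conformalProjective_iff hU hι D φ ψ hx _).2 (hp x hx)⟩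
  · rintro ⟨f, hf, hp⟩
    exact ⟨_, ((hexp.inv₀ fun x _ ↦ Real.exp_ne_zero _).mul hf).add hφ,
      fun x hx ↦ h.isProportionalAt_of_conformalProjective hU hι D φ ψ hx (hp x hx)⟩

/-- Every null frame for `e^u g` is the rescaling of a null frame for `g`. -/
theorem IsNullFrame.exists_of_conformal {g : PseudoRiemannianMetric E M} {ι : M' → M}
    {S : Π x : M', Submodule ℝ (TangentSpace 𝓘(ℝ, E') x)} {U : Set M'}
    {ξ : Π x : M', TangentSpace 𝓘(ℝ, E') x} {N : Π x : M', TangentSpace 𝓘(ℝ, E) (ι x)}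
    {u : C^∞⟮𝓘(ℝ, E), M; ℝ⟯} (h : IsNullFrame (g.conformal u) ι S U ξ N) (hU : IsOpen U)
    (hι : ContMDiff 𝓘(ℝ, E') 𝓘(ℝ, E) ∞ ι) :
    ∃ (ξ₀ : Π x : M', TangentSpace 𝓘(ℝ, E') x) (N₀ : Π x : M', TangentSpace 𝓘(ℝ, E) (ι x)),
      IsNullFrame g ι S U ξ₀ N₀ ∧ (fun x ↦ Real.exp (-(u (ι x)) / 2) • N₀ x) = N := by
  -- Rescaling by `-u` multiplies both fields by `e^{u/2}` and returns the metric to `g`.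
  have h' := h.conformal hU hι (-u)
  rw [g.conformal_conformal_neg u] at h'
  refine ⟨_, _, h', funext fun x ↦ ?_⟩
  rw [smul_smul, ← Real.exp_add]
  have : -(u (ι x)) / 2 + -((-u) (ι x)) / 2 = 0 := by
    simp only [ContMDiffMap.coe_neg, Pi.neg_apply]
    ring
  rw [this, Real.exp_zero, one_smul]

theorem isUmbilicalPoint_conformalProjective_iff [FiniteDimensional ℝ E]
    (g : PseudoRiemannianMetric E M) (D : AffineConnection E M) (φ ψ : C^∞⟮𝓘(ℝ, E), M; ℝ⟯)
    {ι : M' → M} (hι : ContMDiff 𝓘(ℝ, E') 𝓘(ℝ, E) ∞ ι)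
    (S : Π x : M', Submodule ℝ (TangentSpace 𝓘(ℝ, E') x)) (x : M') :
    IsUmbilicalPoint g D ι S x ↔
      IsUmbilicalPoint (g.conformal (φ + ψ)) (conformalProjective D g φ ψ) ι S x := by
  constructor
  · rintro ⟨U, ξ, N, hU, hx, h, hc⟩
    exact ⟨U, _, _, hU, hx, h.conformal hU hι (φ + ψ),
      (h.exists_isProportionalAt_conformalProjective_iff hU hι D φ ψ hx).1 hc⟩
  · rintro ⟨U, ξ, N, hU, hx, h, hc⟩
    -- Only `N` has to be matched, since `β` does not depend on `ξ`.
    obtain ⟨ξ₀, N₀, h₀, rfl⟩ := h.exists_of_conformal hU hι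
    exact ⟨U, ξ₀, N₀, hU, hx, h₀,
      (h₀.exists_isProportionalAt_conformalProjective_iff hU hι D φ ψ hx).2 hc⟩

theorem isUmbilical_conformalProjective_iff [FiniteDimensional ℝ E]
    (g : PseudoRiemannianMetric E M) (D : AffineConnection E M) (φ ψ : C^∞⟮𝓘(ℝ, E), M; ℝ⟯)
    {ι : M' → M} (hι : ContMDiff 𝓘(ℝ, E') 𝓘(ℝ, E) ∞ ι)
    (S : Π x : M', Submodule ℝ (TangentSpace 𝓘(ℝ, E') x)) :
    IsUmbilical g D ι S ↔
      IsUmbilical (g.conformal (φ + ψ)) (conformalProjective D g φ ψ) ι S := by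
  refine forall_congr' fun x ↦ ⟨?_, ?_⟩
  · rintro ⟨U, ξ, N, hU, hx, h, hc⟩
    exact ⟨U, _, _, hU, hx, h.conformal hU hι (φ + ψ),
      (h.isUmbilicalOn_conformalProjective_iff hU hι D φ ψ).1 hc⟩
  · rintro ⟨U, ξ, N, hU, hx, h, hc⟩
    obtain ⟨ξ₀, N₀, h₀, rfl⟩ := h.exists_of_conformal hU hι
    exact ⟨U, ξ₀, N₀, hU, hx, h₀,
      (h₀.isUmbilicalOn_conformalProjective_iff hU hι D φ ψ).2 hc⟩

end

end LightlikeSWMT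

theorem mainTheorem8 (n : ℕ)
    {M : Type*} [TopologicalSpace M] [T2Space M] [SecondCountableTopology M]
    [ChartedSpace (EuclideanSpace ℝ (Fin (n + 2))) M] [IsManifold (𝓡 (n + 2)) ∞ M]
    {M' : Type*} [TopologicalSpace M'] [T2Space M'] [SecondCountableTopology M']
    [ChartedSpace (EuclideanSpace ℝ (Fin (n + 1))) M'] [IsManifold (𝓡 (n + 1)) ∞ M']
    (g : PseudoRiemannianMetric (EuclideanSpace ℝ (Fin (n + 2))) M)
    (η : OneForm (EuclideanSpace ℝ (Fin (n + 2))) M)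
    (D : AffineConnection (EuclideanSpace ℝ (Fin (n + 2))) M)
    (hD : CovariantDerivative.ContMDiffCovariantDerivative D ∞)
    (hSW : IsSemiWeylWithTorsion g η D)
    (φ ψ : C^∞⟮𝓡 (n + 2), M; ℝ⟯)
    (ι : M' → M) (hι : IsImmersion (𝓡 (n + 1)) (𝓡 (n + 2)) ∞ ι)
    (hlight : IsLightlike (E' := EuclideanSpace ℝ (Fin (n + 1))) g ι)
    (S : Π x : M', Submodule ℝ (TangentSpace (𝓡 (n + 1)) x))
    (hS : IsScreenDistribution g ι S) (hint : IsIntegrable S) :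
    let g₁ := g.conformal (φ + ψ)
    let D₁ := conformalProjective D g φ ψ
    -- `M'` is lightlike for the changed metric as well, with the same screen distribution
    IsLightlike (E' := EuclideanSpace ℝ (Fin (n + 1))) g₁ ι ∧ IsScreenDistribution g₁ ι S ∧
    -- the law of change of `β`, and its consequences for a given normalization of `N`
    (∀ (U : Set M') (ξ : Π x : M', TangentSpace (𝓡 (n + 1)) x)
        (N : Π x : M', TangentSpace (𝓡 (n + 2)) (ι x)), IsOpen U → IsNullFrame g ι S U ξ N →
      let N₁ : Π x : M', TangentSpace (𝓡 (n + 2)) (ι x) :=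
        fun x ↦ Real.exp (-(φ (ι x) + ψ (ι x)) / 2) • N x
      IsNullFrame g₁ ι S U (fun x ↦ Real.exp (-(φ (ι x) + ψ (ι x)) / 2) • ξ x) N₁ ∧
      (∀ x ∈ U, ∀ X ∈ S x, ∀ Y ∈ S x,
        beta g₁ D₁ ι N₁ x X Y =
          Real.exp ((φ (ι x) + ψ (ι x)) / 2) *
            (beta g D ι N x X Y - differential φ (ι x) (N x) * inducedForm g ι x X Y)) ∧
      (∀ x ∈ U, (∃ c : ℝ, IsProportionalAt g D ι S N x c) ↔
        ∃ c : ℝ, IsProportionalAt g₁ D₁ ι S N₁ x c) ∧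
      (IsUmbilicalOn g D ι S U N ↔ IsUmbilicalOn g₁ D₁ ι S U N₁)) ∧
    -- umbilical points are preserved
    (∀ x : M', IsUmbilicalPoint g D ι S x ↔ IsUmbilicalPoint g₁ D₁ ι S x) ∧
    -- umbilical lightlike hypersurfaces are preserved
    (IsUmbilical g D ι S ↔ IsUmbilical g₁ D₁ ι S) := by
  have hι' := hι.contMDiff
  intro g₁ D₁
  refine ⟨fun x ↦ ?_, ⟨hS.1, fun x ↦ ?_⟩, fun U ξ N hU h ↦ ?_, ?_, ?_⟩
  · rw [radical_conformal]
    exact hlight x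
  · rw [radical_conformal]
    exact hS.2 x
  -- `(φ + ψ) (ι x)` and `φ (ι x) + ψ (ι x)` agree definitionally.
  · exact ⟨h.conformal hU hι' (φ + ψ),
      fun x hx X hX Y hY ↦ h.beta_conformalProjective hU hι' D φ ψ hx hX hY,
      fun x hx ↦ h.exists_isProportionalAt_conformalProjective_iff hU hι' D φ ψ hx,
      h.isUmbilicalOn_conformalProjective_iff hU hι' D φ ψ⟩
  · exact isUmbilicalPoint_conformalProjective_iff g D φ ψ hι' S
  · exact isUmbilical_conformalProjective_iff g D φ ψ hι' S
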